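/- Let $A$ be a (not necessarily unital) $C^*$-algebra. A right $A$-module is an abelian group $E$ with a biadditive, associative right action of the ring $A$, and module homomorphisms are additive maps commuting with the action. By an ideal of $A$ we mean a two-sided, not necessarily norm-closed ideal, that is, an additive subgroup $I\subseteq A$ with $aI\cup Ia\subseteq I$ for all $a\in A$. An ideal $I$ is semiprime if for every ideal $J\subseteq A$ with $J^2\subseteq I$ we have $J\subseteq I$, where $J^2$ is the additive subgroup generated by $\{xy : x,y\in J\}$. Let $P$ be a right $A$-module that is unital, that is, $P=PA$: every $x\in P$ can be written as a finite sum $x=x_1a_1+\cdots+x_na_n$ with $x_j\in P$ and $a_j\in A$. Assume that $P$ is projective, that is, for every surjective homomorphism $f\colon M\to N$ of right $A$-modules and every homomorphism $g\colon P\to N$ there is a homomorphism $h\colon P\to M$ with $f\circ h=g$. Then the trace ideal of $P$, that is, the ideal of $A$ consisting of all finite sums of elements in the images of module homomorphisms $P\to A$, is semiprime. -/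

import Mathlib

open scoped RightActions

universe u v

/-- A right module over a not necessarily unital ring `A`: an abelian group `E` with a
biadditive, associative right action `x <• a`. (If `A` has a unit, it need not act as the
identity.) The right action is encoded, as usual in Mathlib, as an action of `Aᵐᵒᵖ`. -/
class NonUnitalRightModule (A : Type u) (E : Type v) [NonUnitalRing A] [AddCommGroup E]
    extends SMul Aᵐᵒᵖ E where
  protected add_act : ∀ (x y : E) (a : A), (x + y) <• a = x <• a + y <• a
  protected act_add : ∀ (x : E) (a b : A), x <• (a + b) = x <• a + x <• b
  protected act_mul : ∀ (x : E) (a b : A), x <• (a * b) = (x <• a) <• b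

namespace NonUnitalRightModule

/-- The ring `A`, as a right module over itself by multiplication. -/
instance regular (A : Type u) [NonUnitalRing A] : NonUnitalRightModule A A where
  add_act x y a := add_mul x y a
  act_add x a b := mul_add x a b
  act_mul x a b := (mul_assoc x a b).symm

/-- An additive map between right `A`-modules is a module homomorphism if it commutes with the
action of `A`. -/
def IsHom (A : Type*) [NonUnitalRing A] {E F : Type*} [AddCommGroup E] [AddCommGroup F]
    [NonUnitalRightModule A E] [NonUnitalRightModule A F] (f : E →+ F) : Prop :=
  ∀ (x : E) (a : A), f (x <• a) = f x <• a

/-- `E` is unital if `E = EA`, that is, if every element of `E` is a finite sum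
`x₁a₁ + ⋯ + xₙaₙ`. -/
def IsUnital (A : Type*) [NonUnitalRing A] (E : Type*) [AddCommGroup E]
    [NonUnitalRightModule A E] : Prop :=
  ∀ z : E, ∃ (n : ℕ) (x : Fin n → E) (a : Fin n → A), z = ∑ i, x i <• a i

/-- `P` is projective if every homomorphism from `P` to a right module `N` lifts through every
surjective homomorphism of right modules `M → N`. -/
def IsProjective (A : Type u) [NonUnitalRing A] (P : Type v) [AddCommGroup P]
    [NonUnitalRightModule A P] : Prop :=
  ∀ (M N : Type (max u v)) [AddCommGroup M] [AddCommGroup N]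
    [NonUnitalRightModule A M] [NonUnitalRightModule A N] (f : M →+ N) (g : P →+ N),
    IsHom A f → Function.Surjective f → IsHom A g →
      ∃ h : P →+ M, IsHom A h ∧ ∀ x, f (h x) = g x

/-- The trace ideal of a right module `E` over `A`: the set of finite sums of elements in the
images of module homomorphisms `E → A`. It is a two-sided (not necessarily closed) ideal. -/
def traceIdeal (A : Type*) [NonUnitalRing A] (E : Type*) [AddCommGroup E]
    [NonUnitalRightModule A E] : TwoSidedIdeal A :=
  TwoSidedIdeal.mk'
    (AddSubmonoid.closure {a : A | ∃ φ : E →+ A, IsHom A φ ∧ ∃ x, φ x = a} : Set A)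
    (zero_mem _)
    (fun hx hy => add_mem hx hy)
    (fun {x} hx => by
      refine AddSubmonoid.closure_induction (motive := fun y _ => -y ∈ AddSubmonoid.closure
        {a : A | ∃ φ : E →+ A, IsHom A φ ∧ ∃ x, φ x = a}) ?_ ?_ ?_ hx
      · rintro _ ⟨φ, hφ, e, rfl⟩
        exact AddSubmonoid.subset_closure ⟨φ, hφ, -e, map_neg φ e⟩
      · simp
      · intro a b _ _ ha hb
        rw [neg_add]
        exact add_mem ha hb)
    (fun {c x} hx => by
      refine AddSubmonoid.closure_induction (motive := fun y _ => c * y ∈ AddSubmonoid.closure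
        {a : A | ∃ φ : E →+ A, IsHom A φ ∧ ∃ x, φ x = a}) ?_ ?_ ?_ hx
      · rintro _ ⟨φ, hφ, e, rfl⟩
        refine AddSubmonoid.subset_closure ⟨(AddMonoidHom.mulLeft c).comp φ, fun y a => ?_, e, rfl⟩
        change c * φ (y <• a) = (c * φ y) * a
        rw [hφ y a, mul_assoc]
        rfl
      · simp
      · intro a b _ _ ha hb
        rw [mul_add]
        exact add_mem ha hb)
    (fun {x c} hx => by
      refine AddSubmonoid.closure_induction (motive := fun y _ => y * c ∈ AddSubmonoid.closure
        {a : A | ∃ φ : E →+ A, IsHom A φ ∧ ∃ x, φ x = a}) ?_ ?_ ?_ hx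
      · rintro _ ⟨φ, hφ, e, rfl⟩
        exact AddSubmonoid.subset_closure ⟨φ, hφ, e <• c, hφ e c⟩
      · simp
      · intro a b _ _ ha hb
        rw [add_mul]
        exact add_mem ha hb)

end NonUnitalRightModule

namespace TwoSidedIdeal

/-- The product `IJ` of two ideals: the additive subgroup generated by the products `x * y` with
`x ∈ I` and `y ∈ J`. -/
def productSubgroup {A : Type*} [NonUnitalRing A] (I J : TwoSidedIdeal A) : AddSubgroup A :=
  AddSubgroup.closure {z : A | ∃ x ∈ I, ∃ y ∈ J, z = x * y}

/-- An ideal `I` is semiprime if, for every ideal `J`, `J² ⊆ I` implies `J ⊆ I`. -/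
def IsSemiprime {A : Type*} [NonUnitalRing A] (I : TwoSidedIdeal A) : Prop :=
  ∀ J : TwoSidedIdeal A, (productSubgroup J J : Set A) ⊆ (I : Set A) → J ≤ I

end TwoSidedIdeal

/-! ### Factorization and roots in a C⋆-algebra. -/

section CStarAlgebra

open Filter Topology CFC
open scoped NNReal

variable {A : Type*} [NonUnitalCStarAlgebra A] [PartialOrder A] [StarOrderedRing A]

/-! By the dual basis lemma, each t in the trace ideal T is `∑ cᵢ vᵢ` with v = e v for a finite
matrix e over T (`exists_fixed_of_mem_traceIdeal`). Put z = v⋆v. Then v = u z^(1/4), where u is a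
limit of right multiples of v, so that u = e u (`exists_factor_of_eq_sum_mul`). Although T need not
be closed, u = e u puts the entries of u in T, hence z^(1/2) = u⋆u ∈ T; iterating, T contains
z^(1/2ⁿ) for all n ≥ 1. If J² ⊆ T and x ∈ J, take t = (x⋆x)² = w z^(1/4). Then (x⋆x)⁴ ≤ ‖w‖²
z^(1/2), and two square roots give x⋆x ≤ C z^(1/8), so z^(1/32) is a right factor of x and x ∈ T. -/

lemma star_sub_mul_sub_le_of_star_mul_self_le {x p : A} (h : star x * x ≤ star p * p) (y : A) :
    star (x - x * y) * (x - x * y) ≤ star (p - p * y) * (p - p * y) := by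
  -- With c⋆c = p⋆p - x⋆x, the difference of the two sides is again a square.
  obtain ⟨c, hc⟩ := CStarAlgebra.nonneg_iff_eq_star_mul_self.mp (sub_nonneg.mpr h)
  have key : star (p - p * y) * (p - p * y) - star (x - x * y) * (x - x * y)
      = star (c - c * y) * (c - c * y) := by
    have e : ∀ d : A, star (d - d * y) * (d - d * y)
        = star d * d - star d * d * y - star y * (star d * d) + star y * (star d * d) * y := by
      intro d
      simp only [star_sub, star_mul]
      noncomm_ring
    rw [e, e, e, ← hc]
    noncomm_ring
  rw [← sub_nonneg, key]
  exact star_mul_self_nonneg _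

lemma norm_sub_mul_le_of_star_mul_self_le {x p : A} (h : star x * x ≤ star p * p) (y : A) :
    ‖x - x * y‖ ≤ ‖p - p * y‖ := by
  have := CStarAlgebra.norm_le_norm_of_nonneg_of_le (star_mul_self_nonneg _)
    (star_sub_mul_sub_le_of_star_mul_self_le h y)
  rw [CStarRing.norm_star_mul_self, CStarRing.norm_star_mul_self] at this
  exact abs_le_of_sq_le_sq' (by nlinarith) (norm_nonneg _) |>.2

lemma norm_mul_le_of_star_mul_self_le {x p : A} (h : star x * x ≤ star p * p) (y : A) :
    ‖x * y‖ ≤ ‖p * y‖ := by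
  have := CStarAlgebra.norm_le_norm_of_nonneg_of_le (star_mul_self_nonneg (x * y))
    (show star (x * y) * (x * y) ≤ star (p * y) * (p * y) by
      simpa only [star_mul, mul_assoc] using star_left_conjugate_le_conjugate h y)
  rw [CStarRing.norm_star_mul_self, CStarRing.norm_star_mul_self] at this
  exact abs_le_of_sq_le_sq' (by nlinarith) (norm_nonneg _) |>.2

/-- Approximate inverses of a positive element `q`: the elements `q / (q² + (n + 1)⁻²)`. -/
noncomputable def approxInv (q : A) (n : ℕ) : A :=
  cfcₙ (fun t : ℝ => t / (t ^ 2 + (1 / ((n : ℝ) + 1)) ^ 2)) q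

lemma commute_approxInv {q : A} (hq : 0 ≤ q) (n : ℕ) : Commute q (approxInv q n) := by
  have := cfcₙ_commute_cfcₙ (R := ℝ) id (fun t : ℝ => t / (t ^ 2 + (1 / ((n : ℝ) + 1)) ^ 2)) q
  rwa [cfcₙ_id ℝ q hq.isSelfAdjoint] at this

lemma continuous_div_sq_add_sq {δ : ℝ} (hδ : 0 < δ) : Continuous fun t : ℝ => t / (t ^ 2 + δ ^ 2) :=
  continuous_id.div (by fun_prop) fun t => by positivity

lemma norm_sub_mul_mul_approxInv_le {q : A} (hq : 0 ≤ q) (n : ℕ) :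
    ‖q - q * q * approxInv q n‖ ≤ 1 / ((n : ℝ) + 1) := by
  have hδ : 0 < 1 / ((n : ℝ) + 1) := by positivity
  have hc := continuous_div_sq_add_sq hδ
  unfold approxInv
  set δ := 1 / ((n : ℝ) + 1)
  have hcont := hc.continuousOn (s := quasispectrum ℝ q)
  have h : q - q * q * cfcₙ (fun t : ℝ => t / (t ^ 2 + δ ^ 2)) q
      = cfcₙ (fun t : ℝ => t - t * t * (t / (t ^ 2 + δ ^ 2))) q := by
    rw [cfcₙ_sub (fun t : ℝ => t) (fun t => t * t * (t / (t ^ 2 + δ ^ 2))) q,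
      cfcₙ_mul (fun t : ℝ => t * t) (fun t => t / (t ^ 2 + δ ^ 2)) q,
      cfcₙ_mul (fun t : ℝ => t) (fun t => t) q, cfcₙ_id' ℝ q]
  rw [h]
  refine norm_cfcₙ_le fun t _ => ?_
  have hd : 0 < t ^ 2 + δ ^ 2 := by positivity
  have e : t - t * t * (t / (t ^ 2 + δ ^ 2)) = t * δ ^ 2 / (t ^ 2 + δ ^ 2) := by
    field_simp
    ring
  rw [e, Real.norm_eq_abs, abs_div, abs_of_pos hd, div_le_iff₀ hd, abs_mul,
    abs_of_pos (pow_pos hδ 2)]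
  -- AM-GM: 2|t|δ ≤ t² + δ².
  nlinarith [sq_nonneg (|t| - δ), sq_abs t, abs_nonneg t]

lemma tendsto_mul_mul_approxInv {q : A} (hq : 0 ≤ q) :
    Tendsto (fun n => q * q * approxInv q n) atTop (𝓝 q) := by
  rw [tendsto_iff_norm_sub_tendsto_zero]
  refine squeeze_zero (fun _ => norm_nonneg _) (fun n => ?_)
    tendsto_one_div_add_atTop_nhds_zero_nat
  rw [norm_sub_rev]
  exact norm_sub_mul_mul_approxInv_le hq n

/-- The hypothesis bounds ‖x y‖ by ‖q² y‖, so x inherits the Cauchy property from q² `approxInv q n`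
→ q. The fourth power of q provides the room for convergence in norm. -/
lemma exists_tendsto_mul_approxInv {x q : A} (hq : 0 ≤ q)
    (h : star x * x ≤ (q * q) * (q * q)) :
    ∃ u, Tendsto (fun n => x * approxInv q n) atTop (𝓝 u) ∧ x = u * q := by
  have hs : star (q * q) = q * q := by simp [hq.isSelfAdjoint.star_eq]
  have h' : star x * x ≤ star (q * q) * (q * q) := by rwa [hs]
  have hlim := tendsto_mul_mul_approxInv hq
  have hcau : CauchySeq fun n => x * approxInv q n := by
    rw [Metric.cauchySeq_iff]
    intro ε hε
    obtain ⟨N, hN⟩ := Metric.cauchySeq_iff.mp hlim.cauchySeq ε hε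
    refine ⟨N, fun m hm n hn => lt_of_le_of_lt ?_ (hN m hm n hn)⟩
    rw [dist_eq_norm, dist_eq_norm, ← mul_sub, ← mul_sub]
    exact norm_mul_le_of_star_mul_self_le h' _
  obtain ⟨u, hu⟩ := cauchySeq_tendsto_of_complete hcau
  refine ⟨u, hu, ?_⟩
  refine tendsto_nhds_unique (f := fun n => x * approxInv q n * q) (l := atTop) ?_
    (hu.mul_const q)
  rw [tendsto_iff_norm_sub_tendsto_zero]
  have h0 : Tendsto (fun n => ‖q * q - q * q * (approxInv q n * q)‖) atTop (𝓝 0) := by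
    have := ((hlim.mul_const q).const_sub (q * q)).norm
    simpa [mul_assoc] using this
  refine squeeze_zero (fun _ => norm_nonneg _) (fun n => ?_) h0
  rw [norm_sub_rev, mul_assoc]
  exact norm_sub_mul_le_of_star_mul_self_le h' _

lemma nnrpow_quarter_mul (z : A) :
    z ^ (1 / 4 : ℝ≥0) * z ^ (1 / 4 : ℝ≥0) = z ^ (1 / 2 : ℝ≥0) := by
  rw [← nnrpow_add (by norm_num) (by norm_num)]
  congr 1
  rw [← NNReal.coe_inj]; push_cast; norm_num

lemma nnrpow_half_mul (z : A) (hz : 0 ≤ z) :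
    z ^ (1 / 2 : ℝ≥0) * z ^ (1 / 2 : ℝ≥0) = z := by
  rw [← sqrt_eq_nnrpow, sqrt_mul_sqrt_self z]

/-- A finite family `v` with `v = e v` for a matrix `e` admits a polar-type factorization
`v = u |v|^(1/2)` with `u = e u`. -/
lemma exists_factor_of_eq_sum_mul {ι : Type*} [Fintype ι] {e : ι → ι → A} {v : ι → A}
    (hv : ∀ i, v i = ∑ j, e i j * v j) {z : A} (hz : z = ∑ i, star (v i) * v i) :
    ∃ u : ι → A, (∀ i, u i = ∑ j, e i j * u j) ∧ (∀ i, v i = u i * z ^ (1 / 4 : ℝ≥0)) ∧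
      z ^ (1 / 2 : ℝ≥0) = ∑ i, star (u i) * u i := by
  have hz0 : 0 ≤ z := hz ▸ Finset.sum_nonneg fun i _ => star_mul_self_nonneg _
  set q := z ^ (1 / 4 : ℝ≥0) with hq_def
  have hq : 0 ≤ q := nnrpow_nonneg
  have hqq : q * q = z ^ (1 / 2 : ℝ≥0) := nnrpow_quarter_mul z
  have hq4 : (q * q) * (q * q) = z := by rw [hqq, nnrpow_half_mul z hz0]
  have hle : ∀ i, star (v i) * v i ≤ (q * q) * (q * q) := fun i => by
    rw [hq4, hz]
    exact Finset.single_le_sum (f := fun i => star (v i) * v i)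
      (fun i _ => star_mul_self_nonneg _) (Finset.mem_univ i)
  choose u hu huq using fun i => exists_tendsto_mul_approxInv hq (hle i)
  refine ⟨u, fun i => ?_, huq, ?_⟩
  · refine tendsto_nhds_unique (hu i) ?_
    have := tendsto_finsetSum Finset.univ fun j _ => (hu j).const_mul (e i j)
    refine this.congr fun n => ?_
    rw [hv i, Finset.sum_mul]
    simp only [mul_assoc]
  · rw [← hqq]
    -- Writing aₙ for `approxInv q n`, the product is aₙ z aₙ = ∑ (vᵢ aₙ)⋆(vᵢ aₙ), which also tends
    -- to ∑ uᵢ⋆uᵢ.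
    have h1 : Tendsto (fun n => (approxInv q n * (q * q)) * (q * q * approxInv q n)) atTop
        (𝓝 (q * q)) := by
      refine Tendsto.mul ?_ (tendsto_mul_mul_approxInv hq)
      refine (tendsto_mul_mul_approxInv hq).congr fun n => ?_
      exact ((commute_approxInv hq n).mul_left (commute_approxInv hq n)).eq
    refine tendsto_nhds_unique h1 ?_
    have := tendsto_finsetSum Finset.univ fun i _ => ((hu i).star).mul (hu i)
    refine this.congr fun n => ?_
    have : (approxInv q n * (q * q)) * (q * q * approxInv q n)
        = approxInv q n * z * approxInv q n := by
      rw [← hq4]; simp only [mul_assoc]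
    rw [this, hz, Finset.mul_sum, Finset.sum_mul]
    simp only [star_mul, (show IsSelfAdjoint (approxInv q n) from cfcₙ_predicate _ q).star_eq, mul_assoc]

/-- Each factorization halves the exponent and yields a column fixed by the same e, so it can be
repeated. -/
lemma nnrpow_mem_of_eq_sum_mul {ι : Type*} [Fintype ι] {T : TwoSidedIdeal A} {e : ι → ι → A}
    (he : ∀ i j, e i j ∈ T) (n : ℕ) {v : ι → A} (hv : ∀ i, v i = ∑ j, e i j * v j) {z : A}
    (hz : z = ∑ i, star (v i) * v i) : z ^ ((1 / 2) ^ (n + 1) : ℝ≥0) ∈ T := by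
  obtain ⟨u, heu, -, hu⟩ := exists_factor_of_eq_sum_mul hv hz
  induction n generalizing v z u with
  | zero =>
    rw [zero_add, pow_one, hu]
    refine sum_mem fun i _ => T.mul_mem_left _ _ ?_
    rw [heu]
    exact sum_mem fun j _ => T.mul_mem_right _ _ (he i j)
  | succ n ih =>
    obtain ⟨u', heu', -, hu'⟩ := exists_factor_of_eq_sum_mul heu hu
    have := ih heu hu u' heu' hu'
    rwa [nnrpow_nnrpow, ← pow_succ'] at this

lemma le_of_mul_self_le_mul_self_of_nonneg {a b : A} (ha : 0 ≤ a) (hb : 0 ≤ b)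
    (h : a * a ≤ b * b) : a ≤ b := by
  simpa only [sqrt_mul_self a ha, sqrt_mul_self b hb] using sqrt_le_sqrt _ _ h

/-- If the ideal `T` contains `z ^ (1 / 32)` and `(x* x)² ∈ A z ^ (1 / 4)`, then `x ∈ T`. -/
lemma mem_of_star_mul_self_sq_eq_mul {T : TwoSidedIdeal A} {x w z : A}
    (hT : z ^ (1 / 32 : ℝ≥0) ∈ T)
    (h : (star x * x) * (star x * x) = w * z ^ (1 / 4 : ℝ≥0)) : x ∈ T := by
  have hadd : ∀ {r s : ℝ≥0}, 0 < r → s = r + r → z ^ r * z ^ r = z ^ s := fun hr hs => by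
    rw [hs, nnrpow_add hr hr]
  -- Since s² = k¹⁶, a 16th root lets the norm be absorbed into k.
  obtain ⟨D, hD0, hD⟩ : ∃ D : ℝ, 0 ≤ D ∧ D ^ 16 = ‖star w * w‖ :=
    ⟨‖star w * w‖ ^ ((16 : ℕ) : ℝ)⁻¹, by positivity,
      Real.rpow_inv_natCast_pow (norm_nonneg _) (by norm_num)⟩
  set k := z ^ (1 / 32 : ℝ≥0) with hk
  set s := z ^ (1 / 4 : ℝ≥0) with hs
  have hk0 : 0 ≤ D • k := smul_nonneg hD0 nnrpow_nonneg
  have sq_nn : ∀ a : A, 0 ≤ a → 0 ≤ a * a := fun a ha => ha.isSelfAdjoint.mul_self_nonneg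
  have hks : ((k * k) * (k * k)) * ((k * k) * (k * k)) = s := by
    rw [hadd (s := 1 / 16) (by norm_num) (by rw [← NNReal.coe_inj]; push_cast; norm_num),
      hadd (s := 1 / 8) (by norm_num) (by rw [← NNReal.coe_inj]; push_cast; norm_num),
      hadd (s := 1 / 4) (by norm_num) (by rw [← NNReal.coe_inj]; push_cast; norm_num)]
  have hs0 : 0 ≤ s := nnrpow_nonneg
  have hxx : 0 ≤ star x * x := star_mul_self_nonneg x
  have hle : ((star x * x) * (star x * x)) * ((star x * x) * (star x * x))
      ≤ D ^ 16 • (s * s) := by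
    have h1 : ((star x * x) * (star x * x)) * ((star x * x) * (star x * x))
        = star s * (star w * w) * s := by
      nth_rw 1 [← (sq_nn _ hxx).isSelfAdjoint.star_eq]
      rw [h, star_mul]
      simp only [mul_assoc]
    rw [h1, hD]
    have := CStarAlgebra.star_left_conjugate_le_norm_smul (a := s) (b := star w * w)
    rwa [hs0.isSelfAdjoint.star_eq] at this ⊢
  -- Two square roots reduce (D k)¹⁶ to (D k)⁴, the form needed to split off the factor D k.
  have hbound : star x * x ≤ ((D • k) * (D • k)) * ((D • k) * (D • k)) := by
    refine le_of_mul_self_le_mul_self_of_nonneg hxx (sq_nn _ (sq_nn _ hk0)) ?_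
    refine le_of_mul_self_le_mul_self_of_nonneg (sq_nn _ hxx)
      (sq_nn _ (sq_nn _ (sq_nn _ hk0))) (hle.trans_eq ?_)
    rw [← hks]
    simp only [smul_mul_smul_comm]
    congr 1
    ring
  obtain ⟨u, -, hu⟩ := exists_tendsto_mul_approxInv hk0 hbound
  rw [hu, mul_smul_comm, ← smul_mul_assoc]
  exact T.mul_mem_left _ _ hT

/-- An ideal of a C⋆-algebra is semiprime if each of its elements is a combination of the entries of
a column fixed by some square matrix over the ideal. -/
lemma TwoSidedIdeal.isSemiprime_of_forall_exists_fixed {A : Type*} [NonUnitalCStarAlgebra A]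
    {T : TwoSidedIdeal A}
    (hT : ∀ t ∈ T, ∃ (ι : Type _) (_ : Fintype ι) (e : ι → ι → A) (c v : ι → A),
      (∀ i j, e i j ∈ T) ∧ (∀ i, v i = ∑ j, e i j * v j) ∧ t = ∑ i, c i * v i) :
    T.IsSemiprime := by
  let _ : PartialOrder A := CStarAlgebra.spectralOrder A
  have : StarOrderedRing A := CStarAlgebra.spectralOrderedRing A
  intro J hJ x hx
  have hx2 : star x * x ∈ J := J.mul_mem_left _ _ hx
  have ht : (star x * x) * (star x * x) ∈ T :=
    hJ (AddSubgroup.subset_closure ⟨_, hx2, _, hx2, rfl⟩)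
  obtain ⟨ι, _, e, c, v, he, hv, hcv⟩ := hT _ ht
  obtain ⟨u, -, huv, -⟩ := exists_factor_of_eq_sum_mul hv rfl
  refine mem_of_star_mul_self_sq_eq_mul (w := ∑ i, c i * u i) (z := ∑ i, star (v i) * v i)
    ?_ ?_
  · have := nnrpow_mem_of_eq_sum_mul he 4 hv rfl
    norm_num at this ⊢
    exact this
  · rw [hcv, Finset.sum_mul]
    exact Finset.sum_congr rfl fun i _ => by rw [mul_assoc, ← huv i]

end CStarAlgebra

/-! ### Dual bases and the trace ideal. -/

namespace NonUnitalRightModule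

section DualBasis

variable {A : Type u} [NonUnitalRing A]

/-- Projectivity is tested on modules in `Type (max u v)`, so P must be lifted to serve as a target.
-/
instance ulift {P : Type v} [AddCommGroup P] [NonUnitalRightModule A P] :
    NonUnitalRightModule A (ULift.{u} P) where
  smul a x := ⟨a • x.down⟩
  add_act x y a := ULift.ext _ _ (NonUnitalRightModule.add_act x.down y.down a)
  act_add x a b := ULift.ext _ _ (NonUnitalRightModule.act_add x.down a b)
  act_mul x a b := ULift.ext _ _ (NonUnitalRightModule.act_mul x.down a b)

noncomputable instance finsupp {ι : Type v} : NonUnitalRightModule A (ι →₀ A) where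
  smul a x := x.mapRange (fun b => b * a.unop) (zero_mul _)
  add_act x y a := Finsupp.ext fun i => add_mul (x i) (y i) a
  act_add x a b := Finsupp.ext fun i => mul_add (x i) a b
  act_mul x a b := Finsupp.ext fun i => (mul_assoc (x i) a b).symm

variable {P : Type v} [AddCommGroup P] [NonUnitalRightModule A P]

/-- The action of `A` on a fixed vector, as an additive map. -/
def actHom (p : P) : A →+ P :=
  AddMonoidHom.mk' (fun a => p <• a) (NonUnitalRightModule.act_add p)

/-- Right multiplication by a fixed scalar, as an additive map. -/
def actBy (a : A) : P →+ P :=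
  AddMonoidHom.mk' (fun p => p <• a) fun x y => NonUnitalRightModule.add_act x y a

/-- The canonical map `A^(P) → P`. -/
noncomputable def linearCombination (A : Type u) [NonUnitalRing A] (P : Type v) [AddCommGroup P]
    [NonUnitalRightModule A P] : (P →₀ A) →+ P :=
  Finsupp.liftAddHom fun p => actHom p

lemma isHom_linearCombination : IsHom A (linearCombination A P) := by
  intro x a
  change Finsupp.sum (x.mapRange (fun b => b * a) (zero_mul a)) (fun p b => p <• b)
    = actBy a (Finsupp.sum x fun p b => p <• b)
  rw [Finsupp.sum_mapRange_index (h := fun p b => p <• b)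
    (fun p => (actHom p : A →+ P).map_zero), map_finsuppSum]
  exact Finsupp.sum_congr fun p _ => NonUnitalRightModule.act_mul p (x p) a

lemma surjective_linearCombination (h : IsUnital A P) :
    Function.Surjective (linearCombination A P) := by
  intro z
  obtain ⟨n, x, a, rfl⟩ := h z
  refine ⟨∑ i, Finsupp.single (x i) (a i), ?_⟩
  rw [map_sum]
  exact Finset.sum_congr rfl fun i _ => Finsupp.liftAddHom_apply_single _ _ _

/-- The dual basis lemma for unital projective right modules. -/
lemma exists_dualBasis (hproj : IsProjective A P) (h : IsUnital A P) :
    ∃ φ : P →+ (P →₀ A), IsHom A φ ∧ ∀ x, (φ x).sum (fun p a => p <• a) = x := by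
  obtain ⟨φ, hφ, hφx⟩ := hproj (P →₀ A) (ULift.{u} P)
    (AddEquiv.ulift.symm.toAddMonoidHom.comp (linearCombination A P))
    AddEquiv.ulift.symm.toAddMonoidHom
    (fun x a => congrArg ULift.up (isHom_linearCombination x a))
    (AddEquiv.ulift.symm.surjective.comp (surjective_linearCombination h))
    (fun x a => rfl)
  exact ⟨φ, hφ, fun x => AddEquiv.ulift.symm.injective (hφx x)⟩

lemma mem_traceIdeal_iff {t : A} : t ∈ traceIdeal A P ↔
    t ∈ AddSubmonoid.closure {a : A | ∃ φ : P →+ A, IsHom A φ ∧ ∃ x, φ x = a} :=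
  TwoSidedIdeal.mem_mk' _ _ _ _ _ _ _

lemma apply_mem_traceIdeal {φ : P →+ A} (hφ : IsHom A φ) (x : P) : φ x ∈ traceIdeal A P :=
  mem_traceIdeal_iff.mpr (AddSubmonoid.subset_closure ⟨φ, hφ, x, rfl⟩)

lemma exists_fixed_of_mem_traceIdeal (hproj : IsProjective A P) (h : IsUnital A P) {t : A}
    (ht : t ∈ traceIdeal A P) :
    ∃ (ι : Type v) (_ : Fintype ι) (e : ι → ι → A) (c v : ι → A),
      (∀ i j, e i j ∈ traceIdeal A P) ∧ (∀ i, v i = ∑ j, e i j * v j) ∧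
        t = ∑ i, c i * v i := by
  obtain ⟨φ, hφ, hφx⟩ := exists_dualBasis hproj h
  refine AddSubmonoid.closure_induction ?_ ?_ ?_ (mem_traceIdeal_iff.mp ht)
  · rintro _ ⟨ψ, hψ, x, rfl⟩
    -- Apply χ to the dual basis expansion of x: coordinates χ give v = e v, and ψ gives t.
    have expand : ∀ χ : P →+ A, IsHom A χ →
        χ x = ∑ j : (φ x).support, χ j * φ x j := fun χ hχ => by
      conv_lhs => rw [← hφx x]
      rw [map_finsuppSum, Finsupp.sum, ← Finset.sum_coe_sort]
      exact Finset.sum_congr rfl fun j _ => hχ _ _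
    have hcoord : ∀ i, IsHom A ((Finsupp.applyAddHom i).comp φ) := fun i y a =>
      DFunLike.congr_fun (hφ y a) i
    exact ⟨(φ x).support, inferInstance, fun i j => φ j i, fun j => ψ j, fun j => φ x j,
      fun i j => apply_mem_traceIdeal (hcoord i) j, fun i => expand _ (hcoord i), expand ψ hψ⟩
  · exact ⟨PEmpty, inferInstance, fun _ _ => 0, fun _ => 0, fun _ => 0,
      fun i => i.elim, fun i => i.elim, by simp⟩
  · rintro a b _ _ ⟨ι, _, e, c, v, he, hv, rfl⟩ ⟨κ, _, e', c', v', he', hv', rfl⟩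
    -- Sums are handled by block diagonal matrices.
    refine ⟨ι ⊕ κ, inferInstance, Matrix.fromBlocks e 0 0 e', Sum.elim c c', Sum.elim v v',
      ?_, ?_, ?_⟩
    · rintro (i | i) (j | j)
      · exact he i j
      · exact TwoSidedIdeal.zero_mem _
      · exact TwoSidedIdeal.zero_mem _
      · exact he' i j
    · rintro (i | i)
      · simpa [Matrix.fromBlocks] using hv i
      · simpa [Matrix.fromBlocks] using hv' i
    · simp

end DualBasis

end NonUnitalRightModule

theorem corollary4p7 {A : Type*} [NonUnitalCStarAlgebra A] {P : Type*} [AddCommGroup P]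
    [NonUnitalRightModule A P]
    (hproj : NonUnitalRightModule.IsProjective A P)
    (hunital : NonUnitalRightModule.IsUnital A P) :
    (NonUnitalRightModule.traceIdeal A P).IsSemiprime :=
  TwoSidedIdeal.isSemiprime_of_forall_exists_fixed fun _ ht =>
    NonUnitalRightModule.exists_fixed_of_mem_traceIdeal hproj hunital ht
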